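/- Conventions. A signature $\Sigma$ is a family of function symbols of finite arities. A $\Sigma$-algebra is a set with an interpretation of these symbols as operations. $Fm(X)$ is the absolutely free $\Sigma$-algebra of formulas with variables in the set $X$, and $\mathrm{var}(\cdot)$ denotes the set of variables occurring in a formula or in a set of formulas. A logic is a pair $l=(\Sigma,\vdash)$ where $\vdash$ is a relation between subsets and elements of $Fm(X)$, for a set $X$, that is reflexive ($\Gamma\vdash\varphi$ if $\varphi\in\Gamma$), monotone, closed under cut, finitary, and structural (invariant under all endomorphisms of $Fm(X)$). An equation $\varphi\approx\psi$ is *regular* if $\mathrm{var}(\varphi)=\mathrm{var}(\psi)$. A variety (a class of all $\Sigma$-algebras satisfying a given set of equations) is *regular* if it can be defined by a set of regular equations. A class $\mathbf K$ of $\Sigma$-algebras has the *amalgamation property* if for all $A,B,C\in\mathbf K$ and injective homomorphisms $i_B:A\to B$, $i_C:A\to C$ there are $D\in\mathbf K$ and injective homomorphisms $e_B:B\to D$, $e_C:C\to D$ with $e_B\circ i_B=e_C\circ i_C$. For a set $E$ of equations and an equation $\varphi\approx\psi$ in variables from $X$, write $E\models_{\mathbf K}\varphi\approx\psi$ if for every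 $A\in\mathbf K$, every homomorphism $h:Fm(X)\to A$ with $h(\eta)=h(\nu)$ for all $\eta\approx\nu$ in $E$ satisfies $h(\varphi)=h(\psi)$. A logic $l$ has *an algebraic semantics in $\mathbf K$ given by* the equation $\delta(x)\approx\varepsilon(x)$ in at most the variable $x$ if for all $\Gamma\cup\{\varphi\}\subseteq Fm(X)$ $$\Gamma\vdash\varphi\iff\{\delta(\gamma)\approx\varepsilon(\gamma)\mid\gamma\in\Gamma\}\models_{\mathbf K}\delta(\varphi)\approx\varepsilon(\varphi).$$ A logic $l$ has the *Craig (entailment) interpolation property* if whenever $\Gamma\vdash\varphi$, there is a set $\Gamma'$ of formulas with variables in $\mathrm{var}(\Gamma)\cap\mathrm{var}(\varphi)$ such that $\Gamma\vdash\psi$ for all $\psi\in\Gamma'$, and $\Gamma'\vdash\varphi$. For a $\Sigma$-algebra $A$ and $F\subseteq A$ let $\Omega^A(F)$ be the greatest congruence $\theta$ of $A$ such that $a\in F$ and $\langle a,b\rangle\in\theta$ imply $b\in F$. The set $F$ is an *$l$-filter* if for all $\Gamma\vdash\varphi$ and all homomorphisms $h:Fm(X)\to A$, $h[\Gamma]\subseteq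 F$ implies $h(\varphi)\in F$. The logic $l$ is *protoalgebraic* if for every $\vdash$-closed set $T\subseteq Fm(X)$ and all $\langle\varphi,\psi\rangle\in\Omega^{Fm(X)}(T)$ one has $T,\varphi\vdash\psi$ and $T,\psi\vdash\varphi$. It is *truth-equational* if there is a set $\tau$ of equations in one variable such that for every algebra $A$, every $l$-filter $F$ on $A$ with $\Omega^A(F)$ equal to the identity relation, and every $a\in A$: $a\in F$ if and only if $\alpha^A(a)=\beta^A(a)$ for all $\alpha\approx\beta$ in $\tau$. **Corollary 5.16.** (a) Let $\mathbf K$ be a regular variety with the amalgamation property. Then every logic with an algebraic semantics in $\mathbf K$ given by a regular equation $\delta(x)\approx\varepsilon(x)$ has the Craig interpolation property. (b) This covers some logics that are neither protoalgebraic nor truth-equational: there are a signature $\Sigma$, a regular variety $\mathbf K$ of $\Sigma$-algebras with the amalgamation property, a regular equation $\delta(x)\approx\varepsilon(x)$, and a logic over $\Sigma$, with a countably infinite set of variables, that has an algebraic semantics in $\mathbf K$ given by $\delta(x)\approx\varepsilon(x)$ and is neither protoalgebraic nor truth-equational. -/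

import Mathlib

/-!
Signatures are algebraic first-order languages `L` (no relation symbols), algebras are
`L`-structures on arbitrary sets, and the formulas with variables in `X` are the terms `L.Term X`.
An algebra homomorphism from the absolutely free algebra `L.Term X` to an algebra `A` is the same
thing as an assignment `h : X → A`, extended to all formulas by `Term.realize h`; a substitution
of `L.Term X` is an assignment `σ : X → L.Term X`, extended by `Term.subst`.
-/

open CategoryTheory

universe u v w u'

namespace AlgLogic

/-- The set of variables that occur in a formula. -/
noncomputable def vars {L : FirstOrder.Language.{u, v}} {X : Type w} (t : L.Term X) : Set X :=
  open Classical in (t.varFinset : Set X)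

/-- A logic over the signature `L` with variables in `X`: a finitary and structural
consequence relation on the algebra of formulas. -/
structure Logic (L : FirstOrder.Language.{u, v}) (X : Type w) where
  /-- The consequence relation `Γ ⊢ φ`. -/
  Entails : Set (L.Term X) → L.Term X → Prop
  reflexivity : ∀ Γ φ, φ ∈ Γ → Entails Γ φ
  cut : ∀ Γ Δ φ, Entails Γ φ → (∀ ψ ∈ Γ, Entails Δ ψ) → Entails Δ φ
  monotonicity : ∀ Γ Δ φ, Γ ⊆ Δ → Entails Γ φ → Entails Δ φ
  finitarity : ∀ Γ φ, Entails Γ φ → ∃ Δ : Set (L.Term X), Δ ⊆ Γ ∧ Δ.Finite ∧ Entails Δ φ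
  structurality : ∀ (Γ) (φ) (σ : X → L.Term X), Entails Γ φ →
    Entails ((fun γ => γ.subst σ) '' Γ) (φ.subst σ)

/-- An equation `φ ≈ ψ` between formulas, as the pair of its two sides. -/
abbrev Equation (L : FirstOrder.Language.{u, v}) (X : Type w) := L.Term X × L.Term X

/-- An equation is regular if its two sides contain exactly the same variables. -/
def Equation.IsRegular {L : FirstOrder.Language.{u, v}} {X : Type w} (e : Equation L X) : Prop :=
  vars e.1 = vars e.2

/-- A regular variety: the class of all algebras that satisfy a given set of regular equations.
Every equation has finitely many variables, so variables indexed by `ℕ` suffice. -/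
def IsRegularVariety {L : FirstOrder.Language.{u, v}} (K : Set (Bundled.{w} L.Structure)) : Prop :=
  ∃ E : Set (Equation L ℕ), (∀ e ∈ E, e.IsRegular) ∧
    ∀ A : Bundled.{w} L.Structure,
      A ∈ K ↔ ∀ e ∈ E, ∀ h : ℕ → A, e.1.realize h = e.2.realize h

/-- Equational consequence relative to `K`: the equation `e` holds under every assignment into
a member of `K` that satisfies all the equations in `E`. -/
def EqConsequence {L : FirstOrder.Language.{u, v}} {X : Type u'} (K : Set (Bundled.{w} L.Structure))
    (E : Set (Equation L X)) (e : Equation L X) : Prop :=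
  ∀ A ∈ K, ∀ h : X → A, (∀ q ∈ E, q.1.realize h = q.2.realize h) →
    e.1.realize h = e.2.realize h

/-- For an equation `δ(x) ≈ ε(x)` in the single variable `x`, the equation `δ(φ) ≈ ε(φ)`. -/
def Equation.apply {L : FirstOrder.Language.{u, v}} {X : Type w} (e : Equation L Unit) (φ : L.Term X) :
    Equation L X :=
  (e.1.subst fun _ => φ, e.2.subst fun _ => φ)

/-- The logic `l` has an algebraic semantics in `K` given by the set `τ` of equations in at most
one variable. -/
def HasAlgebraicSemantics {L : FirstOrder.Language.{u, v}} {X : Type u'} (l : Logic L X)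
    (K : Set (Bundled.{w} L.Structure)) (τ : Set (Equation L Unit)) : Prop :=
  ∀ (Γ : Set (L.Term X)) (φ : L.Term X),
    l.Entails Γ φ ↔
      ∀ e ∈ τ, EqConsequence K {q | ∃ γ ∈ Γ, ∃ e' ∈ τ, q = e'.apply γ} (e.apply φ)

/-- The Craig (entailment) interpolation property. -/
def CraigInterpolation {L : FirstOrder.Language.{u, v}} {X : Type w} (l : Logic L X) : Prop :=
  ∀ (Γ : Set (L.Term X)) (φ : L.Term X), l.Entails Γ φ →
    ∃ Γ' : Set (L.Term X), (∀ ψ ∈ Γ', vars ψ ⊆ (⋃ γ ∈ Γ, vars γ) ∩ vars φ) ∧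
      (∀ ψ ∈ Γ', l.Entails Γ ψ) ∧ l.Entails Γ' φ

/-- The absolutely free algebra structure on the set of formulas. -/
instance termStructure (L : FirstOrder.Language.{u, v}) (X : Type w) : L.Structure (L.Term X) where
  funMap f ts := FirstOrder.Language.Term.func f ts
  RelMap _ _ := False

/-- An equivalence relation that is compatible with all operations of the algebra. -/
def IsCongruence (L : FirstOrder.Language.{u, v}) {A : Type w} [L.Structure A] (θ : Setoid A) : Prop :=
  ∀ (n : ℕ) (f : L.Functions n) (a b : Fin n → A), (∀ i, θ (a i) (b i)) →
    θ (FirstOrder.Language.Structure.funMap f a) (FirstOrder.Language.Structure.funMap f b)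

/-- The Leibniz congruence of a subset `F` of an algebra `A`: the greatest congruence `θ` of `A`
such that `a ∈ F` and `θ a b` imply `b ∈ F`. -/
def leibniz (L : FirstOrder.Language.{u, v}) {A : Type w} [L.Structure A] (F : Set A) : Setoid A :=
  sSup {θ | IsCongruence L θ ∧ ∀ a b, a ∈ F → θ a b → b ∈ F}

/-- `F` is a filter of the logic `l` on the algebra `A`. -/
def IsFilter {L : FirstOrder.Language.{u, v}} {X : Type u'} (l : Logic L X) {A : Type w} [L.Structure A]
    (F : Set A) : Prop :=
  ∀ (Γ : Set (L.Term X)) (φ : L.Term X), l.Entails Γ φ →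
    ∀ h : X → A, (∀ γ ∈ Γ, γ.realize h ∈ F) → φ.realize h ∈ F

/-- `l` is protoalgebraic: whenever `T` is a theory of `l` and `φ`, `ψ` are related by the Leibniz
congruence of `T`, then `T, φ ⊢ ψ` and `T, ψ ⊢ φ`. -/
def Protoalgebraic {L : FirstOrder.Language.{u, v}} {X : Type w} (l : Logic L X) : Prop :=
  ∀ T : Set (L.Term X), (∀ φ, l.Entails T φ → φ ∈ T) →
    ∀ φ ψ : L.Term X, leibniz L T φ ψ →
      l.Entails (insert φ T) ψ ∧ l.Entails (insert ψ T) φ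

/-- `l` is truth-equational: some set of equations in one variable defines the filter of every
reduced matrix of `l`, that is, of every algebra `A` with a filter `F` of `l` whose Leibniz
congruence is the identity. -/
def TruthEquational {L : FirstOrder.Language.{u, v}} {X : Type w} (l : Logic L X) : Prop :=
  ∃ τ : Set (Equation L Unit), ∀ (A : Type (max u w)) [L.Structure A] (F : Set A),
    IsFilter l F → leibniz L F = ⊥ →
      ∀ a : A, a ∈ F ↔ ∀ e ∈ τ, e.1.realize (fun _ => a) = e.2.realize (fun _ => a)

end AlgLogic

/-!
For part (a), let `Γ ⊢ φ`. If `x` occurs in `δ` and `ε`, the formulas of `Γ` whose variables all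
occur in `φ` already entail `φ`, so they form an interpolant. To see this, adjoin to an algebra
`A ∈ K` an absorbing element `∞`: a term takes the value `∞` exactly when one of its variables
does, so every regular equation of `A` survives (`AlgLogic.IsRegularVariety.option_mem`). Given an
assignment into `A`, send the variables outside `φ` to `∞`. Each `γ ∈ Γ` with a variable outside `φ`
then satisfies `δ(γ) = ∞ = ε(γ)`, while the values of all other formulas concerned stay the same. If
`x` occurs in neither `δ` nor `ε`, then any nonempty set of formulas entails every formula, and the
closed formula `δ` is an interpolant unless `Γ` is empty, when `∅` is one.

For part (b), take algebras with one unary operation `¬` satisfying `¬¬x ≈ x`, and the logic of the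
fixed points of `¬`, given by `x ≈ ¬x`. A formula is a variable preceded by some number of `¬`, and
it denotes a fixed point exactly when its variable does; hence `Γ ⊢ φ` if and only if the variable of
`φ` is the variable of some `γ ∈ Γ`. This logic is not trivial and has no theorems. The theory `∅` then
refutes protoalgebraicity, and the trivial algebra, on which both `∅` and the whole algebra are
filters, refutes truth-equationality.
-/

namespace AlgLogic

open FirstOrder FirstOrder.Language

/-! ### Variables of formulas -/

section Vars

variable {L : FirstOrder.Language.{u, v}} {X : Type w}

@[simp]
theorem vars_var (x : X) : vars (Term.var x : L.Term X) = {x} := by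
  simp [vars, Term.varFinset]

@[simp]
theorem vars_func {n : ℕ} (f : L.Functions n) (ts : Fin n → L.Term X) :
    vars (Term.func f ts) = ⋃ i, vars (ts i) := by
  ext x
  simp [vars, Term.varFinset]

theorem vars_subst_subset {Y : Type*} (t : L.Term X) (σ : X → L.Term Y) :
    vars (t.subst σ) ⊆ ⋃ x ∈ vars t, vars (σ x) := by
  induction t with
  | var x => simp [Term.subst]
  | func f ts ih =>
    simp only [Term.subst, vars_func]
    refine Set.iUnion_subset fun i => (ih i).trans ?_
    exact Set.biUnion_subset_biUnion_left (Set.subset_iUnion (fun i => vars (ts i)) i)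

theorem realize_congr_vars {A : Type*} [L.Structure A] (t : L.Term X) {g h : X → A}
    (H : ∀ x ∈ vars t, g x = h x) : t.realize g = t.realize h := by
  induction t with
  | var x => exact H x (by simp)
  | func f ts ih =>
    simp only [Term.realize_func]
    congr 1
    funext i
    exact ih i fun x hx => H x (by simpa using ⟨i, hx⟩)

theorem Equation.apply_realize_iff {A : Type*} [L.Structure A] (e : Equation L Unit) (φ : L.Term X)
    (h : X → A) : (e.apply φ).1.realize h = (e.apply φ).2.realize h ↔
      e.1.realize (fun _ => φ.realize h) = e.2.realize (fun _ => φ.realize h) := by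
  simp [Equation.apply]

/-- Consequence in a logic whose algebraic semantics is given by a single equation, in terms of
assignments. -/
theorem HasAlgebraicSemantics.entails_iff {l : Logic L X} {K : Set (Bundled.{u'} L.Structure)}
    {e : Equation L Unit} (hl : HasAlgebraicSemantics l K {e}) (Γ : Set (L.Term X)) (φ : L.Term X) :
    l.Entails Γ φ ↔ ∀ A ∈ K, ∀ h : X → A,
      (∀ γ ∈ Γ, e.1.realize (fun _ => γ.realize h) = e.2.realize (fun _ => γ.realize h)) →
        e.1.realize (fun _ => φ.realize h) = e.2.realize (fun _ => φ.realize h) := by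
  rw [hl Γ φ]
  simp only [Set.mem_singleton_iff, forall_eq, exists_eq_left, EqConsequence,
    Equation.apply_realize_iff, Set.mem_ofPred_eq, forall_exists_index, and_imp]
  refine forall₃_congr fun A _ h => imp_congr_left ⟨fun H γ hγ => ?_, ?_⟩
  · exact (Equation.apply_realize_iff e γ h).1 (H _ γ hγ rfl)
  · rintro H _ γ hγ rfl
    exact (Equation.apply_realize_iff e γ h).2 (H γ hγ)

end Vars

/-! ### Adjoining an absorbing element -/

section Absorbing

variable {L : FirstOrder.Language.{u, v}} {X : Type w} {A : Type u'} [L.Structure A]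

open Classical in
/-- The algebra `A` with an additional element `none` that is absorbing: an operation has the value
`none` as soon as one of its arguments is `none`. -/
noncomputable instance optionStructure : L.Structure (Option A) where
  funMap f ts :=
    if H : ∀ i, ∃ a, ts i = some a then some (Structure.funMap f fun i => (H i).choose) else none
  RelMap _ _ := False

theorem funMap_some {n : ℕ} (f : L.Functions n) (a : Fin n → A) :
    Structure.funMap f (fun i => some (a i)) = some (Structure.funMap f a) := by
  have H : ∀ i, ∃ b, some (a i) = some b := fun i => ⟨a i, rfl⟩
  have hc : (fun i => (H i).choose) = a :=
    funext fun i => (Option.some.inj (H i).choose_spec).symm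
  exact (dif_pos H).trans (by rw [hc])

theorem funMap_none {n : ℕ} (f : L.Functions n) (ts : Fin n → Option A) (i : Fin n)
    (hi : ts i = none) : Structure.funMap f ts = none := by
  refine dif_neg fun H => ?_
  obtain ⟨a, ha⟩ := H i
  simp [hi] at ha

theorem realize_eq_some (t : L.Term X) {h : X → Option A} {g : X → A}
    (H : ∀ x ∈ vars t, h x = some (g x)) : t.realize h = some (t.realize g) := by
  induction t with
  | var x => exact H x (by simp)
  | func f ts ih =>
    have : (fun i => (ts i).realize h) = fun i => some ((ts i).realize g) :=
      funext fun i => ih i fun x hx => H x (by simpa using ⟨i, hx⟩)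
    rw [Term.realize_func, this, funMap_some, Term.realize_func]

theorem realize_eq_none (t : L.Term X) {h : X → Option A} {x : X} (hx : x ∈ vars t)
    (hn : h x = none) : t.realize h = none := by
  induction t with
  | var y =>
    obtain rfl : x = y := by simpa using hx
    exact hn
  | func f ts ih =>
    obtain ⟨i, hi⟩ : ∃ i, x ∈ vars (ts i) := by simpa using hx
    exact funMap_none f _ i (ih i hi)

/-- A regular equation that holds in `A` still holds after an absorbing element is adjoined. -/
theorem Equation.IsRegular.realize_option {e : Equation L X} (he : e.IsRegular)
    (hA : ∀ g : X → A, e.1.realize g = e.2.realize g) (h : X → Option A) :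
    e.1.realize h = e.2.realize h := by
  by_cases hn : ∃ x ∈ vars e.1, h x = none
  · obtain ⟨x, hx, hx'⟩ := hn
    rw [realize_eq_none _ hx hx', realize_eq_none _ (he ▸ hx) hx']
  push Not at hn
  cases isEmpty_or_nonempty A with
  | inl hE =>
    -- Algebras may be empty; then `Option A` has only one element.
    exact Subsingleton.elim _ _
  | inr hne =>
    have hg : ∀ x ∈ vars e.1, h x = some ((h x).getD (Classical.arbitrary A)) := fun x hx => by
      obtain ⟨a, ha⟩ := Option.ne_none_iff_exists'.1 (hn x hx)
      simp [ha]
    rw [realize_eq_some _ hg, realize_eq_some (g := fun x => (h x).getD _) e.2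
      fun x hx => hg x (he ▸ hx), hA]

theorem IsRegularVariety.option_mem {K : Set (Bundled.{u'} L.Structure)} (hK : IsRegularVariety K)
    {A : Bundled.{u'} L.Structure} (hA : A ∈ K) :
    (⟨Option A, inferInstance⟩ : Bundled.{u'} L.Structure) ∈ K := by
  obtain ⟨E, hE, hKE⟩ := hK
  exact (hKE _).2 fun e he => (hE e he).realize_option ((hKE A).1 hA e he)

end Absorbing

/-! ### Interpolation -/

section Interpolation

variable {L : FirstOrder.Language.{u, v}} {X : Type w} {K : Set (Bundled.{u'} L.Structure)}
  {l : Logic L X} {e : Equation L Unit}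

/-- If `x` occurs in `δ(x) ≈ ε(x)`, the premises with a variable outside the conclusion are
redundant. -/
theorem entails_sep_vars_subset (hK : IsRegularVariety K) (he : e.IsRegular) (hx : () ∈ vars e.1)
    (hl : HasAlgebraicSemantics l K {e}) {Γ : Set (L.Term X)} {φ : L.Term X} (h : l.Entails Γ φ) :
    l.Entails {γ ∈ Γ | vars γ ⊆ vars φ} φ := by
  classical
  rw [hl.entails_iff] at h ⊢
  intro A hA g hg
  let g' : X → Option A := fun x => if x ∈ vars φ then some (g x) else none
  have hg' : ∀ x ∈ vars φ, g' x = some (g x) := fun x hx => if_pos hx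
  have hsome : ∀ (t : L.Term Unit) (γ : L.Term X), vars γ ⊆ vars φ →
      t.realize (fun _ => γ.realize g') = some (t.realize fun _ => γ.realize g) := fun t γ hγ =>
    realize_eq_some t fun _ _ => realize_eq_some γ fun x hx => hg' x (hγ hx)
  have key := h _ (hK.option_mem hA) g' fun γ hγ => by
    by_cases hs : vars γ ⊆ vars φ
    · exact (hsome _ γ hs).trans ((congrArg some (hg γ ⟨hγ, hs⟩)).trans (hsome _ γ hs).symm)
    · obtain ⟨x, hx', hxn⟩ := Set.not_subset.1 hs
      have hn : γ.realize g' = none := realize_eq_none γ hx' (if_neg hxn)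
      exact (realize_eq_none e.1 hx hn).trans (realize_eq_none e.2 (he ▸ hx) hn).symm
  exact Option.some.inj ((hsome _ φ subset_rfl).symm.trans (key.trans (hsome _ φ subset_rfl)))

/-- If `x` does not occur in `δ(x) ≈ ε(x)`, this equation says the same about all formulas. -/
theorem entails_of_closed (he : e.IsRegular) (hx : () ∉ vars e.1)
    (hl : HasAlgebraicSemantics l K {e}) {Γ : Set (L.Term X)} (hΓ : Γ.Nonempty) (φ : L.Term X) :
    l.Entails Γ φ := by
  obtain ⟨γ, hγ⟩ := hΓ
  refine (hl.entails_iff _ _).2 fun A _ h hh => ?_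
  rw [realize_congr_vars e.1 (h := fun _ => γ.realize h) fun x hx' => absurd hx' hx,
    realize_congr_vars e.2 (h := fun _ => γ.realize h) fun x hx' => absurd (he ▸ hx') hx]
  exact hh γ hγ

theorem craigInterpolation_of_isRegularVariety (hK : IsRegularVariety K) (he : e.IsRegular)
    (hl : HasAlgebraicSemantics l K {e}) : CraigInterpolation l := by
  intro Γ φ h
  by_cases hx : () ∈ vars e.1
  · exact ⟨{γ ∈ Γ | vars γ ⊆ vars φ},
      fun ψ hψ => Set.subset_inter (Set.subset_biUnion_of_mem (u := vars) hψ.1) hψ.2,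
      fun ψ hψ => l.reflexivity _ _ hψ.1, entails_sep_vars_subset hK he hx hl h⟩
  obtain rfl | hΓ := Γ.eq_empty_or_nonempty
  · exact ⟨∅, by simp, by simp, h⟩
  · refine ⟨{e.1.subst fun _ => φ}, ?_, fun ψ _ => entails_of_closed he hx hl hΓ ψ,
      entails_of_closed he hx hl (Set.singleton_nonempty _) φ⟩
    rintro ψ rfl
    refine (vars_subst_subset _ _).trans (Set.iUnion₂_subset fun x hx' => absurd hx' hx)

end Interpolation

/-! ### Logics without theorems -/

section NoTheorems

variable {L : FirstOrder.Language.{u, v}} {X : Type w} {l : Logic L X}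

theorem not_protoalgebraic_of_no_theorems (h0 : ∀ φ, ¬ l.Entails ∅ φ) {φ ψ : L.Term X}
    (h : ¬ l.Entails {φ} ψ) : ¬ Protoalgebraic l := by
  intro hp
  -- The Leibniz congruence of the empty theory is the total relation.
  have htop : leibniz L (∅ : Set (L.Term X)) φ ψ :=
    (le_sSup ⟨fun _ _ _ _ _ => trivial, fun _ _ ha => ha.elim⟩ :
      (⊤ : Setoid (L.Term X)) ≤ leibniz L ∅) trivial
  exact h (by simpa using (hp ∅ (fun φ hφ => (h0 φ hφ).elim) φ ψ htop).1)

/-- On the trivial algebra both the empty set and the whole algebra are filters of a logic without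
theorems, and both are reduced; no set of equations can define both. -/
theorem not_truthEquational_of_no_theorems (h0 : ∀ φ, ¬ l.Entails ∅ φ) : ¬ TruthEquational l := by
  rintro ⟨τ, hτ⟩
  let _ : L.Structure PUnit.{max u w + 1} :=
    { funMap := fun _ _ => PUnit.unit, RelMap := fun _ _ => False }
  have hbot : ∀ F : Set PUnit.{max u w + 1}, leibniz L F = ⊥ := fun F =>
    Setoid.ext fun a b => by simp [Subsingleton.elim a b]
  have huniv := hτ PUnit Set.univ (fun _ _ _ _ _ => trivial) (hbot _) PUnit.unit
  have hempty := hτ PUnit ∅ (fun Γ φ hφ h hΓ => h0 φ (by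
    rwa [Set.eq_empty_of_forall_notMem (s := Γ) fun γ hγ => hΓ γ hγ] at hφ)) (hbot _) PUnit.unit
  exact hempty.2 (huniv.1 trivial)

end NoTheorems

/-! ### The logic of fixed points of an involution -/

/-- The function symbols of the signature with a single unary symbol `¬`. -/
inductive NegSymbol : ℕ → Type
  | neg : NegSymbol 1

/-- The signature with a single unary operation symbol `¬`. -/
def negLang : FirstOrder.Language.{0, 0} := ⟨NegSymbol, fun _ => Empty⟩

instance negLang_isAlgebraic : negLang.IsAlgebraic := fun _ => inferInstanceAs (IsEmpty Empty)

/-- The symbol `¬`, as a function symbol of `negLang`. -/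
def negSymbol : negLang.Functions 1 := NegSymbol.neg

section Negation

variable {A : Type*} {X : Type*}

/-- The interpretation of `¬` in an algebra. -/
def neg [negLang.Structure A] (a : A) : A :=
  Structure.funMap negSymbol fun _ => a

/-- The algebra in which `¬` is interpreted as the given map. -/
@[reducible]
def negStructure (f : A → A) : negLang.Structure A where
  funMap F ts := match F, ts with
    | NegSymbol.neg, ts => f (ts 0)
  RelMap _ _ := False

theorem funMap_negSymbol [negLang.Structure A] (ts : Fin 1 → A) :
    Structure.funMap negSymbol ts = neg (ts 0) := by
  refine congrArg (Structure.funMap negSymbol) (funext fun i => ?_)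
  rw [Subsingleton.elim i 0]

/-- An injective map that commutes with `¬` is an embedding. -/
def negEmbedding {B : Type*} [negLang.Structure A] [negLang.Structure B] (f : A → B)
    (hf : Function.Injective f) (hneg : ∀ a, f (neg a) = neg (f a)) : A ↪[negLang] B where
  toFun := f
  inj' := hf
  map_fun' := by
    rintro _ ⟨⟩ ts
    exact (congrArg f (funMap_negSymbol ts)).trans
      ((hneg _).trans (funMap_negSymbol (f ∘ ts)).symm)
  map_rel' := fun r => r.elim

theorem map_neg_embedding {B : Type*} [negLang.Structure A] [negLang.Structure B]
    (f : A ↪[negLang] B) (a : A) : f (neg a) = neg (f a) :=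
  f.map_fun negSymbol _

/-- The formula `¬φ`. -/
def negTerm (φ : negLang.Term X) : negLang.Term X :=
  Term.func negSymbol fun _ => φ

@[simp]
theorem realize_negTerm [negLang.Structure A] (φ : negLang.Term X) (h : X → A) :
    (negTerm φ).realize h = neg (φ.realize h) := rfl

@[simp]
theorem vars_negTerm (φ : negLang.Term X) : vars (negTerm φ) = vars φ := by
  rw [negTerm, vars_func, Set.iUnion_const]

/-- The only variable of a formula `¬…¬x`. -/
def root : negLang.Term X → X
  | .var x => x
  | .func NegSymbol.neg ts => root (ts 0)

theorem root_subst {Y : Type*} (t : negLang.Term X) (σ : X → negLang.Term Y) :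
    root (t.subst σ) = root (σ (root t)) := by
  induction t with
  | var x => rfl
  | func f ts ih =>
    cases f
    exact ih 0

theorem realize_fixed_iff [negLang.Structure A] (hA : ∀ a : A, neg (neg a) = a)
    (t : negLang.Term X) (h : X → A) :
    t.realize h = neg (t.realize h) ↔ h (root t) = neg (h (root t)) := by
  induction t with
  | var x => rfl
  | func f ts ih =>
    cases f
    refine Iff.trans ?_ (ih 0)
    have : (Term.func NegSymbol.neg ts : negLang.Term X).realize h = neg ((ts 0).realize h) :=
      funMap_negSymbol _
    rw [this, hA]
    exact eq_comm

end Negation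

/-- The variety of algebras in which `¬` is an involution. -/
def involutive : Set (Bundled.{w} negLang.Structure) :=
  {A | ∀ a : A, neg (neg a) = a}

theorem isRegularVariety_involutive : IsRegularVariety involutive.{w} := by
  refine ⟨{(negTerm (negTerm (Term.var 0)), Term.var 0)}, ?_, fun A => ?_⟩
  · rintro e rfl
    simp [Equation.IsRegular]
  · simp only [Set.mem_singleton_iff, forall_eq, realize_negTerm, Term.realize_var]
    exact ⟨fun hA h => hA _, fun hA a => hA fun _ => a⟩

/-- The amalgam of `B` and `C` over `A` is the disjoint union of `B` and the part of `C` outside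
the image of `A`. -/
theorem amalgamation_involutive : Amalgamation involutive.{w} := by
  classical
  intro A B C i j _ hB hC
  let D := B ⊕ {c : C // c ∉ Set.range j}
  let q : C → D := fun c =>
    if hc : c ∈ Set.range j then Sum.inl (i hc.choose) else Sum.inr ⟨c, hc⟩
  have q_map : ∀ a, q (j a) = Sum.inl (i a) := fun a => by
    have hc : j a ∈ Set.range j := ⟨a, rfl⟩
    simp only [q, dif_pos hc]
    rw [j.injective hc.choose_spec]
  have q_out : ∀ c : {c : C // c ∉ Set.range j}, q c = Sum.inr c := fun c => dif_neg c.2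
  have q_inj : Function.Injective q := by
    intro c d hcd
    by_cases hc : c ∈ Set.range j <;> by_cases hd : d ∈ Set.range j
    · obtain ⟨a, rfl⟩ := hc
      obtain ⟨b, rfl⟩ := hd
      rw [q_map, q_map] at hcd
      rw [i.injective (Sum.inl.inj hcd)]
    · obtain ⟨a, rfl⟩ := hc
      rw [q_map, q_out ⟨d, hd⟩] at hcd
      cases hcd
    · obtain ⟨b, rfl⟩ := hd
      rw [q_map, q_out ⟨c, hc⟩] at hcd
      cases hcd
    · rw [q_out ⟨c, hc⟩, q_out ⟨d, hd⟩] at hcd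
      exact congrArg Subtype.val (Sum.inr.inj hcd)
  let f : D → D := Sum.elim (fun b => Sum.inl (neg b)) fun c => q (neg c.1)
  have f_q : ∀ c, q (neg c) = f (q c) := fun c => by
    by_cases hc : c ∈ Set.range j
    · obtain ⟨a, rfl⟩ := hc
      rw [← map_neg_embedding, q_map, q_map, map_neg_embedding]
      rfl
    · rw [q_out ⟨c, hc⟩]
      rfl
  let _ : negLang.Structure D := negStructure f
  refine ⟨⟨D, inferInstance⟩, negEmbedding Sum.inl Sum.inl_injective fun _ => rfl,
    negEmbedding q q_inj f_q, ?_, ?_⟩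
  · rintro (b | c)
    · exact congrArg Sum.inl (hB b)
    · change f (f (Sum.inr c)) = Sum.inr c
      rw [← q_out, ← f_q, ← f_q, hC]
  · ext a
    exact (q_map a).symm

/-- The equation `x ≈ ¬x`. -/
def fixedEq : Equation negLang Unit := (Term.var (), negTerm (Term.var ()))

/-- The logic of fixed points of involutions, described syntactically: `φ` follows from `Γ` when
some formula of `Γ` has the same variable as `φ`. -/
def fixedLogic (X : Type w) : Logic negLang X where
  Entails Γ φ := ∃ γ ∈ Γ, root γ = root φ
  reflexivity Γ φ h := ⟨φ, h, rfl⟩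
  cut := by
    rintro Γ Δ φ ⟨γ, hγ, hr⟩ h
    obtain ⟨δ, hδ, hr'⟩ := h γ hγ
    exact ⟨δ, hδ, hr'.trans hr⟩
  monotonicity := by
    rintro Γ Δ φ h ⟨γ, hγ, hr⟩
    exact ⟨γ, h hγ, hr⟩
  finitarity := by
    rintro Γ φ ⟨γ, hγ, hr⟩
    exact ⟨{γ}, by simpa using hγ, Set.finite_singleton γ, γ, rfl, hr⟩
  structurality := by
    rintro Γ φ σ ⟨γ, hγ, hr⟩
    exact ⟨_, ⟨γ, hγ, rfl⟩, by rw [root_subst, root_subst, hr]⟩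

/-- For completeness, the countermodel is `ℤ` with `n ↦ -n`, where `0` is the only fixed point. -/
theorem hasAlgebraicSemantics_fixedLogic (X : Type w) :
    HasAlgebraicSemantics (fixedLogic X) involutive.{0} {fixedEq} := by
  classical
  intro Γ φ
  have hfix : ∀ A ∈ involutive.{0}, ∀ (t : negLang.Term X) (h : X → A),
      (fixedEq.apply t).1.realize h = (fixedEq.apply t).2.realize h ↔
        h (root t) = neg (h (root t)) := fun A hA t h =>
    (Equation.apply_realize_iff fixedEq t h).trans (realize_fixed_iff hA t h)
  constructor
  · rintro ⟨γ, hγ, hr⟩ e rfl A hA h hh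
    rw [hfix A hA, ← hr]
    exact (hfix A hA γ h).1 (hh _ ⟨γ, hγ, fixedEq, rfl, rfl⟩)
  · intro H
    by_contra hn
    have hZ : (⟨ℤ, negStructure fun n => -n⟩ : Bundled.{0} negLang.Structure) ∈ involutive :=
      fun n => neg_neg (n : ℤ)
    let h : X → ℤ := fun x => if x = root φ then 1 else 0
    have key := (hfix _ hZ φ h).1 (H fixedEq rfl _ hZ h (by
      rintro _ ⟨γ, hγ, e, rfl, rfl⟩
      refine (hfix _ hZ γ h).2 ?_
      have hne : root γ ≠ root φ := fun hr => hn ⟨γ, hγ, hr⟩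
      change h (root γ) = -h (root γ)
      simp [h, hne]))
    change h (root φ) = -h (root φ) at key
    simp [h] at key

end AlgLogic

theorem corollary5p16 :
    (∀ (L : FirstOrder.Language.{u, v}) [L.IsAlgebraic] (X : Type w)
        (K : Set (Bundled.{max u w} L.Structure)),
      AlgLogic.IsRegularVariety K → FirstOrder.Language.Amalgamation K →
      ∀ (l : AlgLogic.Logic L X) (e : AlgLogic.Equation L Unit), e.IsRegular →
        AlgLogic.HasAlgebraicSemantics l K {e} → AlgLogic.CraigInterpolation l) ∧
    (∃ (L : FirstOrder.Language.{0, 0}) (_ : L.IsAlgebraic)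
        (K : Set (Bundled.{0} L.Structure)) (l : AlgLogic.Logic L ℕ)
        (e : AlgLogic.Equation L Unit),
      AlgLogic.IsRegularVariety K ∧ FirstOrder.Language.Amalgamation K ∧ e.IsRegular ∧
        AlgLogic.HasAlgebraicSemantics l K {e} ∧
        ¬ AlgLogic.Protoalgebraic l ∧ ¬ AlgLogic.TruthEquational l) := by
  refine ⟨fun L _ X K hK _ l e he hl =>
    AlgLogic.craigInterpolation_of_isRegularVariety hK he hl, ?_⟩
  have h0 : ∀ φ, ¬ (AlgLogic.fixedLogic ℕ).Entails ∅ φ := fun φ h => by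
    obtain ⟨γ, hγ, -⟩ := h
    exact hγ
  refine ⟨AlgLogic.negLang, inferInstance, AlgLogic.involutive, AlgLogic.fixedLogic ℕ,
    AlgLogic.fixedEq, AlgLogic.isRegularVariety_involutive, AlgLogic.amalgamation_involutive,
    by simp [AlgLogic.Equation.IsRegular, AlgLogic.fixedEq],
    AlgLogic.hasAlgebraicSemantics_fixedLogic ℕ,
    AlgLogic.not_protoalgebraic_of_no_theorems h0
      (φ := FirstOrder.Language.Term.var 0) (ψ := FirstOrder.Language.Term.var 1) ?_,
    AlgLogic.not_truthEquational_of_no_theorems h0⟩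
  rintro ⟨γ, rfl, hr⟩
  exact absurd (show (0 : ℕ) = 1 from hr) zero_ne_one
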